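/- Let $J,K,M,D$ be non-negative integers, let $\mathcal X\subseteq\mathbb R^D$, and let $A:\mathcal X\to\mathbb R^{M\times K}$, $b:\mathcal X\to\mathbb R^K$, $c:\mathcal X\to\mathbb R$ be functions. Let $S\in\mathbb R^{J\times K}$ and $t\in\mathbb R^J$ be such that the polyhedron $\Xi=\{\xi\in\mathbb R^K:\xi\ge 0,\ S\xi=t\}$ is bounded, and suppose that $\Xi$ is contained in the ellipsoid $\{\xi\in\mathbb R^K:\|Q(\xi-o)\|\le r\}$, where $o\in\mathbb R^K_+$, $r>0$, $Q\in\mathbb R^{K\times K}$ is symmetric positive definite, and $\|\cdot\|$ is the Euclidean norm. Let $\mathcal C$ be the cone of symmetric matrices $P\in\mathbb R^{(K+1)\times(K+1)}$ with $\xi^\top P\xi\ge 0$ for all $\xi\ge 0$ (copositive matrices), and let $\mathcal C^0\subseteq\mathcal C$ be the cone of symmetric matrices of the same size that are the sum of a positive semidefinite matrix and an entrywise nonnegative matrix. For $x\in\mathcal X$ let $$Z(x)=\sup_{\xi\in\Xi}\ \|A(x)\xi\|^2+b(x)^\top\xi+c(x).$$ For a cone $\mathcal K\in\{\mathcal C,\mathcal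 C^0\}$, consider the conic program $$\begin{aligned}\inf\quad & c(x)+t^\top\psi+(t\circ t)^\top\phi+\lambda r^2-\lambda\|Qo\|^2+\tau\\ \text{s.t.}\quad & \tau\in\mathbb R,\ \lambda\ge 0,\ \psi,\phi\in\mathbb R^J,\\ & \begin{bmatrix}\lambda Q^\top Q+S^\top\mathrm{diag}(\phi)S-A(x)^\top A(x) & \tfrac12 h\\ \tfrac12 h^\top & \tau\end{bmatrix}\in\mathcal K,\qquad h=S^\top\psi-b(x)-2\lambda Q^\top Qo,\end{aligned}$$ where $\circ$ is the entrywise product. Let $\overline Z(x)$ be its optimal value for $\mathcal K=\mathcal C$ and $\overline Z^{\mathcal C^0}(x)$ its optimal value for $\mathcal K=\mathcal C^0$. Let $\overline Z^{\mathcal S}(x)$ be the optimal value of the approximate $\mathcal S$-lemma semidefinite program $$\begin{aligned}\inf\quad & c(x)+t^\top\theta+\rho r^2-\rho\|Qo\|^2+\kappa\\ \text{s.t.}\quad & \kappa\in\mathbb R,\ \rho\ge 0,\ \theta\in\mathbb R^J,\ \eta\in\mathbb R^K_+,\\ & \begin{bmatrix}\rho Q^\top Q-A(x)^\top A(x) &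 \tfrac12 g\\ \tfrac12 g^\top & \kappa\end{bmatrix}\succeq 0,\qquad g=S^\top\theta-b(x)-\eta-2\rho Q^\top Qo.\end{aligned}$$ All optimal values are taken in $[-\infty,+\infty]$, with $\sup\emptyset=-\infty$ and $\inf\emptyset=+\infty$. Then for every $x\in\mathcal X$, $$Z(x)=\overline Z(x)\le\overline Z^{\mathcal C^0}(x)\le\overline Z^{\mathcal S}(x).$$ -/

import Mathlib

open Matrix

namespace RobustQP

noncomputable section

/-- The Euclidean norm of a coordinate vector. -/
def eNorm {n : ℕ} (v : Fin n → ℝ) : ℝ := ‖(WithLp.toLp 2 v : EuclideanSpace ℝ (Fin n))‖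

/-- The polyhedral uncertainty set `{ξ ≥ 0 : S ξ = t}`. -/
def uncertaintySet {J K : ℕ} (S : Matrix (Fin J) (Fin K) ℝ) (t : Fin J → ℝ) :
    Set (Fin K → ℝ) :=
  {ξ | 0 ≤ ξ ∧ S *ᵥ ξ = t}

/-- The ellipsoid `{ξ : ‖Q (ξ - o)‖ ≤ r}`. -/
def ellipsoid {K : ℕ} (r : ℝ) (Q : Matrix (Fin K) (Fin K) ℝ) (o : Fin K → ℝ) :
    Set (Fin K → ℝ) :=
  {ξ | eNorm (Q *ᵥ (ξ - o)) ≤ r}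

/-- The cone of copositive matrices. -/
def copositiveCone (ι : Type*) [Fintype ι] : Set (Matrix ι ι ℝ) :=
  {P | P.IsSymm ∧ ∀ ξ : ι → ℝ, 0 ≤ ξ → 0 ≤ ξ ⬝ᵥ (P *ᵥ ξ)}

/-- The cone of symmetric matrices that are the sum of a positive semidefinite matrix and an
entrywise nonnegative matrix. -/
def psdPlusNonnegCone (ι : Type*) [Fintype ι] : Set (Matrix ι ι ℝ) :=
  {P | P.IsSymm ∧ ∃ R N : Matrix ι ι ℝ, R.PosSemidef ∧ (∀ i j, 0 ≤ N i j) ∧ P = R + N}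

/-- The bordered symmetric matrix with blocks `P`, `v`, `vᵀ`, `s`. -/
def bordered {K : ℕ} (P : Matrix (Fin K) (Fin K) ℝ) (v : Fin K → ℝ) (s : ℝ) :
    Matrix (Fin K ⊕ Unit) (Fin K ⊕ Unit) ℝ :=
  Matrix.fromBlocks P (Matrix.replicateCol Unit v) (Matrix.replicateRow Unit v)
    (Matrix.of fun _ _ => s)

/-- The worst-case value: the supremum of `‖A ξ‖² + bᵀ ξ + c` over the uncertainty set, as an
extended real number. -/
def worstCaseValue {J K M : ℕ} (S : Matrix (Fin J) (Fin K) ℝ) (t : Fin J → ℝ)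
    (A : Matrix (Fin M) (Fin K) ℝ) (b : Fin K → ℝ) (c : ℝ) : EReal :=
  ⨆ ξ ∈ uncertaintySet S t, ((eNorm (A *ᵥ ξ) ^ 2 + b ⬝ᵥ ξ + c : ℝ) : EReal)

/-- The matrix in the conic constraint of the dual conic program. -/
def conicMatrix {J K M : ℕ} (S : Matrix (Fin J) (Fin K) ℝ)
    (A : Matrix (Fin M) (Fin K) ℝ) (b : Fin K → ℝ)
    (Q : Matrix (Fin K) (Fin K) ℝ) (o : Fin K → ℝ)
    (τ lam : ℝ) (ψ φ : Fin J → ℝ) : Matrix (Fin K ⊕ Unit) (Fin K ⊕ Unit) ℝ :=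
  bordered (lam • (Qᵀ * Q) + Sᵀ * Matrix.diagonal φ * S - Aᵀ * A)
    ((1 / 2 : ℝ) • (Sᵀ *ᵥ ψ - b - (2 * lam) • ((Qᵀ * Q) *ᵥ o))) τ

/-- The optimal value (an infimum of extended reals, `⊤` if infeasible) of the dual conic program
whose matrix constraint is membership in `cone`. -/
def conicValue {J K M : ℕ} (cone : Set (Matrix (Fin K ⊕ Unit) (Fin K ⊕ Unit) ℝ))
    (S : Matrix (Fin J) (Fin K) ℝ) (t : Fin J → ℝ)
    (A : Matrix (Fin M) (Fin K) ℝ) (b : Fin K → ℝ) (c : ℝ)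
    (r : ℝ) (Q : Matrix (Fin K) (Fin K) ℝ) (o : Fin K → ℝ) : EReal :=
  sInf {v : EReal | ∃ (τ lam : ℝ) (ψ φ : Fin J → ℝ), 0 ≤ lam ∧
    conicMatrix S A b Q o τ lam ψ φ ∈ cone ∧
    v = ((c + t ⬝ᵥ ψ + (t * t) ⬝ᵥ φ + lam * r ^ 2 - lam * eNorm (Q *ᵥ o) ^ 2 + τ : ℝ) : EReal)}

/-- The optimal value of the copositive program. -/
def copositiveValue {J K M : ℕ} (S : Matrix (Fin J) (Fin K) ℝ) (t : Fin J → ℝ)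
    (A : Matrix (Fin M) (Fin K) ℝ) (b : Fin K → ℝ) (c : ℝ)
    (r : ℝ) (Q : Matrix (Fin K) (Fin K) ℝ) (o : Fin K → ℝ) : EReal :=
  conicValue (copositiveCone (Fin K ⊕ Unit)) S t A b c r Q o

/-- The optimal value of the semidefinite program obtained by replacing the copositive cone
with the cone of sums of positive semidefinite and nonnegative matrices. -/
def innerValue {J K M : ℕ} (S : Matrix (Fin J) (Fin K) ℝ) (t : Fin J → ℝ)
    (A : Matrix (Fin M) (Fin K) ℝ) (b : Fin K → ℝ) (c : ℝ)
    (r : ℝ) (Q : Matrix (Fin K) (Fin K) ℝ) (o : Fin K → ℝ) : EReal :=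
  conicValue (psdPlusNonnegCone (Fin K ⊕ Unit)) S t A b c r Q o

/-- The optimal value of the approximate S-lemma semidefinite program. -/
def sLemmaValue {J K M : ℕ} (S : Matrix (Fin J) (Fin K) ℝ) (t : Fin J → ℝ)
    (A : Matrix (Fin M) (Fin K) ℝ) (b : Fin K → ℝ) (c : ℝ)
    (r : ℝ) (Q : Matrix (Fin K) (Fin K) ℝ) (o : Fin K → ℝ) : EReal :=
  sInf {v : EReal | ∃ (κ ρ : ℝ) (θ : Fin J → ℝ) (η : Fin K → ℝ), 0 ≤ ρ ∧ 0 ≤ η ∧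
    (bordered (ρ • (Qᵀ * Q) - Aᵀ * A)
      ((1 / 2 : ℝ) • (Sᵀ *ᵥ θ - b - η - (2 * ρ) • ((Qᵀ * Q) *ᵥ o))) κ).PosSemidef ∧
    v = ((c + t ⬝ᵥ θ + ρ * r ^ 2 - ρ * eNorm (Q *ᵥ o) ^ 2 + κ : ℝ) : EReal)}

end

end RobustQP

/-! Weak duality evaluates the conic form at `(ξ, 1)` with `ξ ∈ Ξ` and uses the ellipsoid bound. For
the converse, take a real `m` above the worst-case value and homogenise `m` minus the objective to a
form in `(ξ, σ)`. It is positive at the nonzero nonnegative zeros of `‖S ξ - σ t‖²`: those with `σ >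
0` rescale into `Ξ`, those with `σ = 0` are recession directions (`exists_multiplier`). By
compactness (`exists_penalty`) a multiple of `‖S ξ - σ t‖²` makes it copositive, and this penalty
leaves the dual objective equal to `m`. -/

namespace RobustQP

/-- A quadratic form that is positive on the nonnegative zeros of a nonnegative form becomes
strictly copositive after adding a large multiple of the latter. -/
lemma exists_penalty {ι : Type*} [Fintype ι] (P R : Matrix ι ι ℝ)
    (hR : ∀ ζ : ι → ℝ, 0 ≤ ζ ⬝ᵥ (R *ᵥ ζ))
    (hP : ∀ ζ : ι → ℝ, 0 ≤ ζ → ζ ≠ 0 → ζ ⬝ᵥ (R *ᵥ ζ) = 0 → 0 < ζ ⬝ᵥ (P *ᵥ ζ)) :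
    ∃ N : ℝ, 0 ≤ N ∧ ∀ ζ : ι → ℝ, 0 ≤ ζ → ζ ≠ 0 →
      0 < ζ ⬝ᵥ (P *ᵥ ζ) + N * (ζ ⬝ᵥ (R *ᵥ ζ)) := by
  have hcont : ∀ T : Matrix ι ι ℝ, Continuous fun ζ : ι → ℝ => ζ ⬝ᵥ (T *ᵥ ζ) := fun T =>
    continuous_id.dotProduct (continuous_const.matrix_mulVec continuous_id)
  have hcompact : IsCompact (Metric.sphere (0 : ι → ℝ) 1 ∩ {ζ | 0 ≤ ζ}) :=
    (isCompact_sphere 0 1).inter_right isClosed_Ici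
  -- These open sets grow with `n` because the form of `R` is nonnegative, so one of them contains
  -- the whole compact slice; degree-two homogeneity then handles every `ζ`.
  obtain ⟨n, hn⟩ := hcompact.elim_directed_cover
    (fun n : ℕ => {ζ | 0 < ζ ⬝ᵥ (P *ᵥ ζ) + n * (ζ ⬝ᵥ (R *ᵥ ζ))})
    (fun n => isOpen_lt continuous_const ((hcont P).add (continuous_const.mul (hcont R))))
    (by
      rintro ζ ⟨hζ, hζ0⟩
      have hne : ζ ≠ 0 := by
        rintro rfl
        simp at hζ
      simp only [Set.mem_iUnion, Set.mem_ofPred_eq]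
      rcases (hR ζ).eq_or_lt with h | h
      · exact ⟨0, by simpa using hP ζ hζ0 hne h.symm⟩
      · obtain ⟨n, hn⟩ := exists_nat_gt (-(ζ ⬝ᵥ (P *ᵥ ζ)) / (ζ ⬝ᵥ (R *ᵥ ζ)))
        rw [div_lt_iff₀ h] at hn
        exact ⟨n, by linarith⟩)
    (directed_of_isDirected_le fun m n hmn ζ hζ => by
      have : (m : ℝ) ≤ n := by exact_mod_cast hmn
      have := mul_le_mul_of_nonneg_right this (hR ζ)
      simp only [Set.mem_ofPred_eq] at hζ ⊢
      linarith)
  refine ⟨n, n.cast_nonneg, fun ζ hζ hne => ?_⟩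
  have hpos : 0 < ‖ζ‖ := norm_pos_iff.mpr hne
  have hmem : ‖ζ‖⁻¹ • ζ ∈ Metric.sphere (0 : ι → ℝ) 1 ∩ {ζ | 0 ≤ ζ} :=
    ⟨by simp [norm_smul, hpos.ne'], smul_nonneg (inv_nonneg.mpr hpos.le) hζ⟩
  have h := hn hmem
  simp only [Set.mem_ofPred_eq, mulVec_smul, smul_dotProduct, dotProduct_smul, smul_eq_mul] at h
  have h' := mul_pos (mul_pos hpos hpos) h
  have e : ‖ζ‖ * ‖ζ‖ * (‖ζ‖⁻¹ * (‖ζ‖⁻¹ * (ζ ⬝ᵥ (P *ᵥ ζ))) +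
      n * (‖ζ‖⁻¹ * (‖ζ‖⁻¹ * (ζ ⬝ᵥ (R *ᵥ ζ))))) =
      ζ ⬝ᵥ (P *ᵥ ζ) + n * (ζ ⬝ᵥ (R *ᵥ ζ)) := by
    field_simp
  rwa [e] at h'

/-! ### Quadratic forms of the bordered matrices. -/

lemma eNorm_sq {n : ℕ} (v : Fin n → ℝ) : eNorm v ^ 2 = v ⬝ᵥ v := by
  rw [eNorm, EuclideanSpace.real_norm_sq_eq]
  simp [dotProduct, sq]

lemma dotProduct_transpose_mul_mulVec {m n : ℕ} (A : Matrix (Fin m) (Fin n) ℝ)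
    (u v : Fin n → ℝ) : u ⬝ᵥ ((Aᵀ * A) *ᵥ v) = (A *ᵥ u) ⬝ᵥ (A *ᵥ v) := by
  rw [← mulVec_mulVec, dotProduct_mulVec, vecMul_transpose]

lemma dotProduct_bordered_mulVec {K : ℕ} (P : Matrix (Fin K) (Fin K) ℝ) (v : Fin K → ℝ) (s : ℝ)
    (ξ : Fin K → ℝ) (σ : ℝ) :
    Sum.elim ξ (fun _ => σ) ⬝ᵥ (bordered P v s *ᵥ Sum.elim ξ (fun _ => σ)) =
      ξ ⬝ᵥ (P *ᵥ ξ) + 2 * σ * (v ⬝ᵥ ξ) + s * σ ^ 2 := by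
  rw [bordered, fromBlocks_mulVec, Sum.elim_comp_inl, Sum.elim_comp_inr,
    sumElim_dotProduct_sumElim, dotProduct_add]
  have h1 : replicateCol Unit v *ᵥ (fun _ => σ) = σ • v := by
    ext i; simp [mulVec, dotProduct, mul_comm]
  have h2 : replicateRow Unit v *ᵥ ξ = fun _ => v ⬝ᵥ ξ := rfl
  have h3 : (Matrix.of fun _ _ : Unit => s) *ᵥ (fun _ => σ) = fun _ => s * σ := by
    ext i; simp [mulVec, dotProduct]
  rw [h1, h2, h3, dotProduct_smul, dotProduct_comm ξ v]
  simp only [dotProduct, Finset.univ_unique, Finset.sum_singleton, Pi.add_apply, smul_eq_mul]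
  ring

lemma bordered_isSymm {K : ℕ} {P : Matrix (Fin K) (Fin K) ℝ} (hP : P.IsSymm) (v : Fin K → ℝ)
    (s : ℝ) : (bordered P v s).IsSymm :=
  hP.fromBlocks (transpose_replicateCol v) rfl

lemma psdPlusNonnegCone_subset_copositiveCone (ι : Type*) [Fintype ι] :
    psdPlusNonnegCone ι ⊆ copositiveCone ι := by
  rintro P ⟨hP, R, N, hR, hN, rfl⟩
  refine ⟨hP, fun ξ hξ => ?_⟩
  rw [add_mulVec, dotProduct_add]
  refine add_nonneg (by simpa using hR.dotProduct_mulVec_nonneg ξ) ?_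
  exact dotProduct_nonneg_of_nonneg hξ fun i =>
    Finset.sum_nonneg fun j _ => mul_nonneg (hN i j) (hξ j)

section

variable {J K M : ℕ} (S : Matrix (Fin J) (Fin K) ℝ) (t : Fin J → ℝ)
  (A : Matrix (Fin M) (Fin K) ℝ) (b : Fin K → ℝ) (c r : ℝ)
  (Q : Matrix (Fin K) (Fin K) ℝ) (o : Fin K → ℝ)

lemma conicMatrix_isSymm (τ lam : ℝ) (ψ φ : Fin J → ℝ) :
    (conicMatrix S A b Q o τ lam ψ φ).IsSymm := by
  refine bordered_isSymm ?_ _ _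
  simp [Matrix.IsSymm, transpose_mul, Matrix.mul_assoc]

lemma dotProduct_conicMatrix_mulVec (τ lam : ℝ) (ψ φ : Fin J → ℝ) (ξ : Fin K → ℝ) (σ : ℝ) :
    Sum.elim ξ (fun _ => σ) ⬝ᵥ
        (conicMatrix S A b Q o τ lam ψ φ *ᵥ Sum.elim ξ (fun _ => σ)) =
      lam * ((Q *ᵥ ξ) ⬝ᵥ (Q *ᵥ ξ)) + φ ⬝ᵥ ((S *ᵥ ξ) * (S *ᵥ ξ)) - (A *ᵥ ξ) ⬝ᵥ (A *ᵥ ξ) +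
        σ * (ψ ⬝ᵥ (S *ᵥ ξ) - b ⬝ᵥ ξ - 2 * lam * ((Q *ᵥ o) ⬝ᵥ (Q *ᵥ ξ))) + τ * σ ^ 2 := by
  rw [conicMatrix, dotProduct_bordered_mulVec, sub_mulVec, add_mulVec, smul_mulVec,
    dotProduct_sub, dotProduct_add, dotProduct_smul, dotProduct_transpose_mul_mulVec,
    dotProduct_transpose_mul_mulVec]
  have h1 : ξ ⬝ᵥ ((Sᵀ * diagonal φ * S) *ᵥ ξ) = φ ⬝ᵥ ((S *ᵥ ξ) * (S *ᵥ ξ)) := by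
    rw [← mulVec_mulVec, ← mulVec_mulVec, dotProduct_mulVec, vecMul_transpose]
    simp only [dotProduct, mulVec_diagonal, Pi.mul_apply]
    exact Finset.sum_congr rfl fun i _ => by ring
  have h2 : (Sᵀ *ᵥ ψ) ⬝ᵥ ξ = ψ ⬝ᵥ (S *ᵥ ξ) := by
    rw [mulVec_transpose, dotProduct_mulVec]
  rw [h1, smul_dotProduct, sub_dotProduct, sub_dotProduct, smul_dotProduct, h2,
    dotProduct_comm ((Qᵀ * Q) *ᵥ o) ξ, dotProduct_transpose_mul_mulVec,
    dotProduct_comm (Q *ᵥ ξ) (Q *ᵥ o)]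
  simp only [smul_eq_mul]
  ring

/-! ### Comparison of the programs and weak duality. -/

lemma conicValue_anti {C C' : Set (Matrix (Fin K ⊕ Unit) (Fin K ⊕ Unit) ℝ)} (h : C ⊆ C') :
    conicValue C' S t A b c r Q o ≤ conicValue C S t A b c r Q o := by
  refine sInf_le_sInf ?_
  rintro v ⟨τ, lam, ψ, φ, hlam, hmem, hv⟩
  exact ⟨τ, lam, ψ, φ, hlam, h hmem, hv⟩

/-- With `φ = 0` and `ψ = θ` the two matrices differ only by `η / 2` in the border, which is an
entrywise nonnegative summand. -/
lemma innerValue_le_sLemmaValue :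
    innerValue S t A b c r Q o ≤ sLemmaValue S t A b c r Q o := by
  refine sInf_le_sInf ?_
  rintro v ⟨κ, ρ, θ, η, hρ, hη, hpsd, rfl⟩
  refine ⟨κ, ρ, θ, 0, hρ, ⟨conicMatrix_isSymm .., _, bordered 0 ((1 / 2 : ℝ) • η) 0, hpsd, ?_, ?_⟩,
    by simp⟩
  · rintro (i | i) (j | j)
    · simp [bordered]
    · simpa [bordered] using hη i
    · simpa [bordered] using hη j
    · simp [bordered]
  · ext (i | i) (j | j)
    · simp [bordered, conicMatrix]
    · simp [bordered, conicMatrix]; ring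
    · simp [bordered, conicMatrix]; ring
    · simp [bordered, conicMatrix]

lemma worstCaseValue_le_copositiveValue
    (hsub : uncertaintySet S t ⊆ ellipsoid r Q o) :
    worstCaseValue S t A b c ≤ copositiveValue S t A b c r Q o := by
  refine iSup₂_le fun ξ hξ => le_sInf ?_
  rintro v ⟨τ, lam, ψ, φ, hlam, ⟨-, hcop⟩, rfl⟩
  have h := hcop (Sum.elim ξ fun _ => 1) (by
    rintro (i | i)
    · exact hξ.1 i
    · exact zero_le_one)
  rw [dotProduct_conicMatrix_mulVec, hξ.2] at h
  have he : eNorm (Q *ᵥ (ξ - o)) ^ 2 ≤ r ^ 2 :=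
    pow_le_pow_left₀ (norm_nonneg _) (hsub hξ) 2
  rw [eNorm_sq, mulVec_sub, sub_dotProduct, dotProduct_sub, dotProduct_sub,
    dotProduct_comm (Q *ᵥ ξ) (Q *ᵥ o)] at he
  have he' := mul_le_mul_of_nonneg_left he hlam
  rw [EReal.coe_le_coe_iff, eNorm_sq, eNorm_sq, dotProduct_comm t ψ, dotProduct_comm (t * t) φ]
  linarith

/-! ### Strong duality. -/

/-- A nonempty bounded polyhedron in standard form has trivial recession cone. -/
lemma eq_zero_of_mulVec_eq_zero (hbdd : Bornology.IsBounded (uncertaintySet S t))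
    (hne : (uncertaintySet S t).Nonempty) {ξ : Fin K → ℝ} (hξ : 0 ≤ ξ) (hS : S *ᵥ ξ = 0) :
    ξ = 0 := by
  obtain ⟨ξ₀, h0, h1⟩ := hne
  obtain ⟨B, hB⟩ := hbdd.exists_norm_le
  by_contra hne
  have hpos : 0 < ‖ξ‖ := norm_pos_iff.mpr hne
  obtain ⟨n, hn⟩ := exists_nat_gt ((B + ‖ξ₀‖) / ‖ξ‖)
  rw [div_lt_iff₀ hpos] at hn
  have hle := hB (ξ₀ + (n : ℝ) • ξ) ⟨add_nonneg h0 (smul_nonneg n.cast_nonneg hξ), by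
    rw [mulVec_add, mulVec_smul, hS, h1, smul_zero, add_zero]⟩
  have := norm_sub_le (ξ₀ + (n : ℝ) • ξ) ξ₀
  rw [add_sub_cancel_left, norm_smul, Real.norm_natCast] at this
  linarith

/-- Boundedness of an empty `Ξ` says nothing about recession directions; there a large multiple of
the definite form `‖Q ξ‖²` dominates `‖A ξ‖²`. For nonempty `Ξ` there are none, and `lam = 0`
suffices. -/
lemma exists_multiplier (hbdd : Bornology.IsBounded (uncertaintySet S t)) (hQ : Q.PosDef) :
    ∃ lam : ℝ, 0 ≤ lam ∧ (lam = 0 ∨ uncertaintySet S t = ∅) ∧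
      ∀ ξ : Fin K → ℝ, 0 ≤ ξ → ξ ≠ 0 → S *ᵥ ξ = 0 →
        0 < lam * ((Q *ᵥ ξ) ⬝ᵥ (Q *ᵥ ξ)) - (A *ᵥ ξ) ⬝ᵥ (A *ᵥ ξ) := by
  rcases (uncertaintySet S t).eq_empty_or_nonempty with hE | hne
  · obtain ⟨lam, hlam, h⟩ := exists_penalty (-(Aᵀ * A)) (Qᵀ * Q)
      (fun ζ => by
        rw [dotProduct_transpose_mul_mulVec, ← eNorm_sq]
        positivity)
      (fun ζ _ hne h0 => by
        rw [dotProduct_transpose_mul_mulVec, dotProduct_self_eq_zero] at h0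
        have := hQ.dotProduct_mulVec_pos hne
        simp [h0] at this)
    refine ⟨lam, hlam, Or.inr hE, fun ξ hξ hne _ => ?_⟩
    have := h ξ hξ hne
    rw [neg_mulVec, dotProduct_neg, dotProduct_transpose_mul_mulVec,
      dotProduct_transpose_mul_mulVec] at this
    linarith
  · exact ⟨0, le_rfl, Or.inl rfl, fun ξ hξ hξ0 hS =>
      absurd (eq_zero_of_mulVec_eq_zero S t hbdd hne hξ hS) hξ0⟩

lemma copositiveValue_le_worstCaseValue (hbdd : Bornology.IsBounded (uncertaintySet S t))
    (hQ : Q.PosDef) : copositiveValue S t A b c r Q o ≤ worstCaseValue S t A b c := by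
  rw [← EReal.le_of_forall_lt_iff_le]
  intro m hm
  have hlt : ∀ ξ ∈ uncertaintySet S t, (A *ᵥ ξ) ⬝ᵥ (A *ᵥ ξ) + b ⬝ᵥ ξ + c < m := fun ξ hξ => by
    have := (le_iSup₂ (f := fun ξ (_ : ξ ∈ uncertaintySet S t) =>
      ((eNorm (A *ᵥ ξ) ^ 2 + b ⬝ᵥ ξ + c : ℝ) : EReal)) ξ hξ).trans_lt hm
    rwa [EReal.coe_lt_coe_iff, eNorm_sq] at this
  obtain ⟨lam, hlam, halt, hrec⟩ := exists_multiplier S t A Q hbdd hQ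
  -- Chosen so that the dual objective at `ψ = φ = 0` is `m`.
  set τ := m - c - lam * r ^ 2 + lam * eNorm (Q *ᵥ o) ^ 2 with hτ
  -- the form `‖S ξ - σ t‖²` as an instance of the conic matrix
  have hform : ∀ (ξ : Fin K → ℝ) (σ : ℝ), Sum.elim ξ (fun _ => σ) ⬝ᵥ
      (conicMatrix S (0 : Matrix (Fin M) (Fin K) ℝ) 0 Q o (t ⬝ᵥ t) 0 ((-2 : ℝ) • t) 1 *ᵥ
        Sum.elim ξ (fun _ => σ)) = (S *ᵥ ξ - σ • t) ⬝ᵥ (S *ᵥ ξ - σ • t) := fun ξ σ => by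
    rw [dotProduct_conicMatrix_mulVec, sub_dotProduct, dotProduct_sub, dotProduct_sub,
      dotProduct_comm (S *ᵥ ξ) (σ • t)]
    simp only [smul_dotProduct, dotProduct_smul, smul_eq_mul, zero_mulVec, zero_dotProduct]
    have : (1 : Fin J → ℝ) ⬝ᵥ ((S *ᵥ ξ) * (S *ᵥ ξ)) = (S *ᵥ ξ) ⬝ᵥ (S *ᵥ ξ) := by
      simp [dotProduct]
    rw [this]
    ring
  have hsplit : ∀ ζ : Fin K ⊕ Unit → ℝ,
      ζ = Sum.elim (fun i => ζ (.inl i)) (fun _ => ζ (.inr ())) := fun ζ => by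
    ext (i | i) <;> rfl
  obtain ⟨N, hN, hpos⟩ := exists_penalty (conicMatrix S A b Q o τ lam 0 0)
    (conicMatrix S (0 : Matrix (Fin M) (Fin K) ℝ) 0 Q o (t ⬝ᵥ t) 0 ((-2 : ℝ) • t) 1)
    (fun ζ => by
      rw [hsplit ζ, hform, ← eNorm_sq]
      positivity)
    (fun ζ hζ hne h0 => by
      have hξ : 0 ≤ fun i => ζ (.inl i) := fun i => hζ (.inl i)
      have hσ : 0 ≤ ζ (.inr ()) := hζ (.inr ())
      rw [hsplit ζ] at h0 hne ⊢
      generalize (fun i => ζ (.inl i)) = ξ at *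
      generalize ζ (.inr ()) = σ at *
      rw [hform, dotProduct_self_eq_zero, sub_eq_zero] at h0
      rw [dotProduct_conicMatrix_mulVec]
      rcases hσ.eq_or_lt with rfl | hσ
      · have := hrec ξ hξ (by
          rintro rfl
          exact hne (by ext (i | i) <;> rfl)) (by simpa using h0)
        simpa using this
      · have hmem : σ⁻¹ • ξ ∈ uncertaintySet S t :=
          ⟨smul_nonneg (inv_nonneg.mpr hσ.le) hξ, by
            rw [mulVec_smul, h0, inv_smul_smul₀ hσ.ne']⟩
        rcases halt with rfl | hE
        · have h := hlt _ hmem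
          simp only [mulVec_smul, smul_dotProduct, dotProduct_smul, smul_eq_mul] at h
          -- Clearing denominators by `σ ^ 2` homogenises the strict bound at `ξ / σ`.
          have h' := mul_pos (pow_pos hσ 2) (sub_pos.mpr h)
          have e : σ ^ 2 * (m - (σ⁻¹ * (σ⁻¹ * ((A *ᵥ ξ) ⬝ᵥ (A *ᵥ ξ))) + σ⁻¹ * (b ⬝ᵥ ξ) + c)) =
              -((A *ᵥ ξ) ⬝ᵥ (A *ᵥ ξ)) - σ * (b ⬝ᵥ ξ) + (m - c) * σ ^ 2 := by
            field_simp
            ring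
          rw [e] at h'
          simp only [zero_dotProduct]
          rw [hτ]
          linarith
        · simp [hE] at hmem)
  -- Coefficients of `N * ‖S ξ - σ t‖²`; their contributions `-2N + N + N` to the objective, each
  -- times `t ⬝ᵥ t`, cancel.
  refine sInf_le ⟨τ + N * (t ⬝ᵥ t), lam, (-2 * N) • t, fun _ => N, hlam,
    ⟨conicMatrix_isSymm .., fun ζ hζ => ?_⟩, ?_⟩
  · rcases eq_or_ne ζ 0 with rfl | hne
    · simp
    have h := hpos ζ hζ hne
    rw [hsplit ζ, dotProduct_conicMatrix_mulVec, dotProduct_conicMatrix_mulVec] at h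
    rw [hsplit ζ, dotProduct_conicMatrix_mulVec]
    have e : ∀ w : Fin J → ℝ, (fun _ => N : Fin J → ℝ) ⬝ᵥ w = N * ((1 : Fin J → ℝ) ⬝ᵥ w) :=
      fun w => by simp [dotProduct, Finset.mul_sum]
    rw [e]
    simp only [smul_dotProduct, smul_eq_mul, zero_mulVec, zero_dotProduct] at h ⊢
    linarith
  · have e : (t * t) ⬝ᵥ (fun _ => N : Fin J → ℝ) = N * (t ⬝ᵥ t) := by
      simp [dotProduct, Finset.mul_sum, mul_comm]
    rw [EReal.coe_eq_coe_iff, e, dotProduct_smul, smul_eq_mul, hτ]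
    ring

end

end RobustQP

theorem mainTheorem5 {D J K M : ℕ} (X : Set (Fin D → ℝ))
    (A : X → Matrix (Fin M) (Fin K) ℝ) (b : X → Fin K → ℝ) (c : X → ℝ)
    (S : Matrix (Fin J) (Fin K) ℝ) (t : Fin J → ℝ)
    (hbdd : Bornology.IsBounded (RobustQP.uncertaintySet S t))
    (r : ℝ) (hr : 0 < r) (Q : Matrix (Fin K) (Fin K) ℝ) (hQ : Q.PosDef)
    (o : Fin K → ℝ) (ho : 0 ≤ o)
    (hsub : RobustQP.uncertaintySet S t ⊆ RobustQP.ellipsoid r Q o)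
    (x : X) :
    RobustQP.worstCaseValue S t (A x) (b x) (c x)
        = RobustQP.copositiveValue S t (A x) (b x) (c x) r Q o ∧
      RobustQP.copositiveValue S t (A x) (b x) (c x) r Q o
        ≤ RobustQP.innerValue S t (A x) (b x) (c x) r Q o ∧
      RobustQP.innerValue S t (A x) (b x) (c x) r Q o
        ≤ RobustQP.sLemmaValue S t (A x) (b x) (c x) r Q o := by
  exact ⟨le_antisymm (RobustQP.worstCaseValue_le_copositiveValue _ _ _ _ _ _ _ _ hsub)
      (RobustQP.copositiveValue_le_worstCaseValue _ _ _ _ _ _ _ _ hbdd hQ),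
    RobustQP.conicValue_anti _ _ _ _ _ _ _ _
      (RobustQP.psdPlusNonnegCone_subset_copositiveCone _),
    RobustQP.innerValue_le_sLemmaValue _ _ _ _ _ _ _ _⟩
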